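/- Let $d\ge 1$, let $\epsilon>0$, and let $p^0\in\mathbb{R}^d$ have positive entries summing to $1$. Write $e_1,\dots,e_d$ for the standard basis vectors. The bit-flip randomizer $\mathcal{M}_{\mathrm{bit}}$ maps $x\in\{e_1,\dots,e_d\}$ to a random $z\in\{0,1\}^d$ whose coordinates are independent, with $z_j=x_j$ with probability $\frac{e^{\epsilon/2}}{e^{\epsilon/2}+1}$ and $z_j=1-x_j$ otherwise. Put $$\alpha_\epsilon=\frac{e^{\epsilon/2}-1}{e^{\epsilon/2}+1},\qquad \tilde p^0=\frac{(e^{\epsilon/2}-1)\,p^0+\mathbf 1}{e^{\epsilon/2}+1},\qquad \Pi=I_d-\tfrac1d\mathbf 1\mathbf 1^{\intercal},$$ $$\Sigma(p^0)=\alpha_\epsilon^2\left[\mathrm{Diag}(p^0)-p^0(p^0)^{\intercal}\right]+\frac{e^{\epsilon/2}}{(e^{\epsilon/2}+1)^2}I_d .$$ Then $\Sigma(p^0)$ is invertible. For each $n$ let $X_1,\dots,X_n$ be i.i.d. $\mathrm{Multinomial}(1,p)$, with $p$ possibly depending on $n$. Let $\tilde H=\sum_{i=1}^n \mathcal{M}_{\mathrm{bit}}(X_i)$,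 with independent runs of the randomizer, and let $$T_n=n\left(\frac{\tilde H}{n}-\tilde p^0\right)^{\intercal}\Pi\,\Sigma(p^0)^{-1}\,\Pi\left(\frac{\tilde H}{n}-\tilde p^0\right).$$ (1) If $p=p^0$ (the null hypothesis $\mathrm{H}_0$), then $T_n$ converges in distribution to $\chi^2_{d-1}$ as $n\to\infty$. (2) Let $\Delta\in\mathbb{R}^d$ satisfy $\mathbf 1^{\intercal}\Delta=0$. If $p=p^0+\Delta/\sqrt n$ for all sufficiently large $n$ (so that $p$ is a probability vector), then $T_n$ converges in distribution to the noncentral chi-square distribution with $d-1$ degrees of freedom and noncentrality parameter $\alpha_\epsilon^2\,\Delta^{\intercal}\Sigma(p^0)^{-1}\Delta$. Here $\chi^2_k(\lambda)$ denotes the law of $\sum_{i=1}^k(G_i+m_i)^2$ with $G_i$ independent standard normal and $\sum_i m_i^2=\lambda$, and $\chi^2_k=\chi^2_k(0)$; $\chi^2_0$ is the point mass at $0$. -/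

import Mathlib

open MeasureTheory ProbabilityTheory Filter Topology
open scoped Matrix

noncomputable section

namespace BitFlipGOF

/-- The standard basis vector `e_j`, as an element of `{0,1}^d` (`true` is `1`, `false` is `0`). -/
def oneHot {d : ℕ} (j : Fin d) : Fin d → Bool := fun k => decide (k = j)

/-- The law `Multinomial(1, p)` on `{0,1}^d`: the outcome is `e_j` with probability `p j`.
It is a probability measure exactly when the positive parts of the `p j` sum to one. -/
def multinomialOne {d : ℕ} (p : Fin d → ℝ) : Measure (Fin d → Bool) :=
  ∑ j, ENNReal.ofReal (p j) • Measure.dirac (oneHot j)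

/-- Law of one reported bit: the bit `b` is kept with probability `e^{ε/2} / (e^{ε/2} + 1)` and is
otherwise flipped. -/
def flipBit (ε : ℝ) (b : Bool) : Measure Bool :=
  ENNReal.ofReal (Real.exp (ε / 2) / (Real.exp (ε / 2) + 1)) • Measure.dirac b +
    ENNReal.ofReal (1 / (Real.exp (ε / 2) + 1)) • Measure.dirac (!b)

instance flipBit_isProbabilityMeasure (ε : ℝ) (b : Bool) :
    IsProbabilityMeasure (flipBit ε b) := by
  constructor
  have h : 0 < Real.exp (ε / 2) := Real.exp_pos _
  simp only [flipBit, Measure.coe_add, Measure.coe_smul, Pi.add_apply, Pi.smul_apply,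
    measure_univ, smul_eq_mul, mul_one]
  rw [← ENNReal.ofReal_add (by positivity) (by positivity), ← add_div,
    div_self (by positivity), ENNReal.ofReal_one]

/-- The bit flip local randomizer with privacy parameter `ε`: given `x ∈ {0,1}^d`, the coordinates
of the output are independent, and each is `x j` kept or flipped according to `flipBit ε`. -/
def bitFlip (d : ℕ) (ε : ℝ) : Kernel (Fin d → Bool) (Fin d → Bool) :=
  Kernel.ofFunOfCountable fun x => Measure.pi fun j => flipBit ε (x j)

instance bitFlip_isMarkovKernel (d : ℕ) (ε : ℝ) : IsMarkovKernel (bitFlip d ε) :=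
  ⟨fun x => inferInstanceAs (IsProbabilityMeasure (Measure.pi fun j => flipBit ε (x j)))⟩

/-- `X 1, …, X n` are i.i.d. `Multinomial(1, p)` and `Z i` is the output of the bit flip randomizer
run on `X i`, with independent runs for the different individuals. -/
structure IsBitFlipSample {Ω : Type*} [MeasurableSpace Ω] {n d : ℕ} (ε : ℝ) (p : Fin d → ℝ)
    (X Z : Fin n → Ω → (Fin d → Bool)) (P : Measure Ω) : Prop where
  hasLaw_data : ∀ i, HasLaw (X i) (multinomialOne p) P
  hasCondDistrib_output : ∀ i, HasCondDistrib (Z i) (X i) (bitFlip d ε) P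
  indep : iIndepFun (fun i ω => (X i ω, Z i ω)) P

/-- The private histogram `H̃ = ∑ i, Z i`. -/
def privateHistogram {Ω : Type*} {n d : ℕ} (Z : Fin n → Ω → (Fin d → Bool)) (ω : Ω) :
    Fin d → ℝ :=
  fun j => ∑ i, if Z i ω j then 1 else 0

/-- `α_ε = (e^{ε/2} - 1) / (e^{ε/2} + 1)`. -/
def alphaCoeff (ε : ℝ) : ℝ := (Real.exp (ε / 2) - 1) / (Real.exp (ε / 2) + 1)

/-- The mean vector `p̃ = ((e^{ε/2} - 1) p + 1) / (e^{ε/2} + 1)`. -/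
def flippedMean {d : ℕ} (ε : ℝ) (p : Fin d → ℝ) : Fin d → ℝ :=
  fun j => ((Real.exp (ε / 2) - 1) * p j + 1) / (Real.exp (ε / 2) + 1)

/-- The matrix `Σ(p) = α_ε² (Diag(p) - p pᵀ) + e^{ε/2} / (e^{ε/2} + 1)² I`. -/
def flippedCov {d : ℕ} (ε : ℝ) (p : Fin d → ℝ) : Matrix (Fin d) (Fin d) ℝ :=
  alphaCoeff ε ^ 2 • (Matrix.diagonal p - Matrix.vecMulVec p p) +
    (Real.exp (ε / 2) / (Real.exp (ε / 2) + 1) ^ 2) • (1 : Matrix (Fin d) (Fin d) ℝ)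

/-- The projection matrix `I - (1/d) 1 1ᵀ`. -/
def centering (d : ℕ) : Matrix (Fin d) (Fin d) ℝ :=
  1 - (1 / (d : ℝ)) • Matrix.vecMulVec (fun _ => 1) (fun _ => 1)

/-- The projected statistic `n (H̃/n - p̃⁰)ᵀ Π Σ(p⁰)⁻¹ Π (H̃/n - p̃⁰)`. -/
def bitFlipStatistic {Ω : Type*} {n d : ℕ} (ε : ℝ) (p₀ : Fin d → ℝ)
    (Z : Fin n → Ω → (Fin d → Bool)) (ω : Ω) : ℝ :=
  let v : Fin d → ℝ := fun j => privateHistogram Z ω j / n - flippedMean ε p₀ j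
  n * (v ⬝ᵥ ((centering d * (flippedCov ε p₀)⁻¹ * centering d) *ᵥ v))

/-- The local alternative `p⁰ + Δ / √n`. -/
def localAlternative {d : ℕ} (p₀ Δ : Fin d → ℝ) (n : ℕ) : Fin d → ℝ :=
  fun j => p₀ j + Δ j / √(n : ℝ)

/-- The chi-square distribution with `k` degrees of freedom: the law of the sum of the squares of
`k` independent standard normal variables (the Dirac mass at `0` for `k = 0`). -/
def chiSquare (k : ℕ) : Measure ℝ :=
  (Measure.pi fun _ : Fin k => gaussianReal 0 1).map fun x => ∑ i, x i ^ 2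

/-- The noncentral chi-square distribution with `k` degrees of freedom and noncentrality parameter
`lam ≥ 0`: the law of the sum of the squares of `k` independent normal variables with variance `1`
whose vector of means has squared Euclidean norm `lam`. By rotation invariance only this squared
norm matters, and the vector of means is taken to be `(√lam, 0, …, 0)`. For `k = 0` the only
meaningful parameter is `lam = 0`. -/
def noncentralChiSquare (k : ℕ) (lam : ℝ) : Measure ℝ :=
  (Measure.pi fun i : Fin k => gaussianReal (if (i : ℕ) = 0 then √lam else 0) 1).map
    fun x => ∑ i, x i ^ 2

instance chiSquare_isProbabilityMeasure (k : ℕ) : IsProbabilityMeasure (chiSquare k) :=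
  Measure.isProbabilityMeasure_map (Measurable.aemeasurable (by fun_prop))

instance noncentralChiSquare_isProbabilityMeasure (k : ℕ) (lam : ℝ) :
    IsProbabilityMeasure (noncentralChiSquare k lam) :=
  Measure.isProbabilityMeasure_map (Measurable.aemeasurable (by fun_prop))

end BitFlipGOF

end

/-! The proof is a multivariate central limit theorem followed by whitening of the quadratic form.

Given `X i = e_k`, the bits of a report are independent, so a linear statistic `τ ⬝ᵥ (z - p̃⁰)` has
explicit conditional moments; averaged over `p₀` they give mean `0` and variance `τᵀ Σ τ`. The
characteristic function of the sum of `n` reports is the `n`-th power of a mixture over `k`.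
Expanding to second order at `1/√n`, the shift `Δ/√n` of the weights survives only as a drift `α (τ
⬝ᵥ Δ)` (`tendsto_mixture_charFun_pow`, `tendsto_charFun_scaledStat`).

The vector `1` is an eigenvector of `Σ`. With `Σ⁻¹ = Cᵀ C`, the map `C` therefore sends vectors of
sum zero into the orthogonal complement of `C 1`. Coordinates there, with first axis along `C Δ`,
write the statistic as a sum of `d - 1` squares of linear statistics with limiting covariance `I`
and limiting mean `(√λ, 0, …, 0)` (`exists_whitening`). Lévy's theorem and continuous mapping
conclude; the null hypothesis is `Δ = 0`. -/

namespace BitFlipGOF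

/-! ### Central limit theorem for mixtures with perturbed weights -/

/-- Second order expansion at `0` of the characteristic function of a law with second moment. -/
lemma charFun_sub_taylor_isLittleO (ν : Measure ℝ) [IsProbabilityMeasure ν] (h : MemLp id 2 ν) :
    (fun t : ℝ => charFun ν t - (1 + ((∫ x, x ∂ν : ℝ) : ℂ) * t * Complex.I -
      ((∫ x, x ^ 2 ∂ν : ℝ) : ℂ) * t ^ 2 / 2)) =o[𝓝 0] fun t : ℝ => t ^ 2 := by
  have key := fun t => taylorWithinEval_charFun_two_zero (P := ν) (X := id) (by fun_prop)
    (by simpa using h) t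
  simp only [Measure.map_id, id, Pi.pow_apply] at key
  simp_rw [← key]
  convert! taylor_isLittleO_univ (contDiff_charFun h) using 2
  simp

/-- If `∑ p₀ = 1`, `∑ Δ = 0` and the `p₀`-mixture of the `ν k` is centered, the characteristic
functions of the `(p₀ + Δ / √n)`-mixtures satisfy a central limit theorem. -/
lemma tendsto_mixture_charFun_pow {ι : Type*} [Fintype ι] (ν : ι → Measure ℝ)
    [∀ k, IsProbabilityMeasure (ν k)] (h : ∀ k, MemLp id 2 (ν k)) (p₀ Δ : ι → ℝ)
    (hp₀ : ∑ k, p₀ k = 1) (hΔ : ∑ k, Δ k = 0) (hm : ∑ k, p₀ k * ∫ x, x ∂(ν k) = 0) :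
    Tendsto (fun n : ℕ => (∑ k, ((p₀ k + Δ k / √(n : ℝ) : ℝ) : ℂ) *
        charFun (ν k) (√(n : ℝ))⁻¹) ^ n) atTop
      (𝓝 (Complex.exp (((∑ k, Δ k * ∫ x, x ∂(ν k) : ℝ) : ℂ) * Complex.I -
        ((∑ k, p₀ k * ∫ x, x ^ 2 ∂(ν k) : ℝ) : ℂ) / 2))) := by
  set m : ι → ℝ := fun k => ∫ x, x ∂(ν k)
  set q : ι → ℝ := fun k => ∫ x, x ^ 2 ∂(ν k)
  set r : ι → ℝ → ℂ := fun k t =>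
    charFun (ν k) t - (1 + (m k : ℂ) * t * Complex.I - (q k : ℂ) * t ^ 2 / 2) with hr
  have hs : Tendsto (fun n : ℕ => (√(n : ℝ))⁻¹) atTop (𝓝 0) :=
    tendsto_inv_atTop_zero.comp (Real.tendsto_sqrt_atTop.comp tendsto_natCast_atTop_atTop)
  have hrs : ∀ k, Tendsto (fun n : ℕ => (n : ℂ) * r k (√(n : ℝ))⁻¹) atTop (𝓝 0) := by
    intro k
    have h1 := ((charFun_sub_taylor_isLittleO (ν k) (h k)).comp_tendsto hs).tendsto_inv_smul_nhds_zero
    refine h1.congr fun n => ?_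
    simp [r, m, q, inv_pow]
  have hsC : Tendsto (fun n : ℕ => (((√(n : ℝ))⁻¹ : ℝ) : ℂ)) atTop (𝓝 0) := by
    exact (Complex.continuous_ofReal.tendsto' 0 0 Complex.ofReal_zero).comp hs
  -- With `s = 1/√n`, this sequence is `n` times (mixture minus `1`): the terms of order `1` and `s`
  -- cancel by `hp₀`, `hΔ` and `hm`, and `n s² = 1` normalizes the rest.
  have lim : Tendsto (fun n : ℕ => (∑ k, ((p₀ k : ℂ) + Δ k * (((√(n : ℝ))⁻¹ : ℝ) : ℂ)) *
        ((n : ℂ) * r k (√(n : ℝ))⁻¹)) + ((((∑ k, Δ k * m k : ℝ) : ℂ) * Complex.I -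
        ((∑ k, p₀ k * q k : ℝ) : ℂ) / 2) -
          (((√(n : ℝ))⁻¹ : ℝ) : ℂ) * ((∑ k, Δ k * q k : ℝ) : ℂ) / 2)) atTop
      (𝓝 ((∑ k, ((p₀ k : ℂ) + Δ k * 0) * 0) + ((((∑ k, Δ k * m k : ℝ) : ℂ) * Complex.I -
        ((∑ k, p₀ k * q k : ℝ) : ℂ) / 2) - 0 * ((∑ k, Δ k * q k : ℝ) : ℂ) / 2))) := by
    refine Tendsto.add (tendsto_finsetSum _ fun k _ => ?_) ?_
    · exact (tendsto_const_nhds.add (tendsto_const_nhds.mul hsC)).mul (hrs k)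
    · exact tendsto_const_nhds.sub ((hsC.mul_const _).div_const _)
  simp only [mul_zero, Finset.sum_const_zero, zero_mul, zero_div, sub_zero, zero_add] at lim
  refine (Complex.tendsto_one_add_pow_exp_of_tendsto (g := fun n : ℕ =>
    (∑ k, ((p₀ k + Δ k / √(n : ℝ) : ℝ) : ℂ) * charFun (ν k) (√(n : ℝ))⁻¹) - 1) ?_).congr
      fun n => by simp
  refine lim.congr' ?_
  filter_upwards [eventually_gt_atTop 0] with n hn
  have hn' : (0 : ℝ) < n := by exact_mod_cast hn
  set s : ℝ := (√(n : ℝ))⁻¹ with hsdef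
  have hns : (n : ℂ) * (s : ℂ) ^ 2 = 1 := by
    have : (n : ℝ) * s ^ 2 = 1 := by
      rw [hsdef, inv_pow, Real.sq_sqrt hn'.le, mul_inv_cancel₀ hn'.ne']
    exact_mod_cast this
  have e1 : ∀ k, ((p₀ k + Δ k / √(n : ℝ) : ℝ) : ℂ) * charFun (ν k) s =
      ((p₀ k : ℂ) + Δ k * s) * r k s + ((p₀ k : ℂ) + (Δ k : ℂ) * s +
        ((p₀ k * m k : ℝ) : ℂ) * s * Complex.I + ((Δ k * m k : ℝ) : ℂ) * s ^ 2 * Complex.I -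
        ((p₀ k * q k : ℝ) : ℂ) * s ^ 2 / 2 - ((Δ k * q k : ℝ) : ℂ) * s ^ 3 / 2) := by
    intro k
    rw [div_eq_mul_inv, ← hsdef]
    simp only [hr]
    push_cast
    ring
  simp_rw [e1, Finset.sum_add_distrib, Finset.sum_sub_distrib, Finset.sum_add_distrib,
    ← Finset.sum_div, ← Finset.sum_mul, ← Complex.ofReal_sum]
  rw [hp₀, hΔ, hm, Finset.sum_congr rfl fun k _ => mul_left_comm _ _ _, ← Finset.mul_sum]
  push_cast
  linear_combination (-1 : ℂ) * ((∑ k, (Δ k : ℂ) * m k) * Complex.I - (∑ k, (p₀ k : ℂ) * q k) / 2 -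
    s * (∑ k, (Δ k : ℂ) * q k) / 2) * hns

/-! ### Law and characteristic function of the reports -/

/-- The law of a privatized report is a mixture of product laws. -/
lemma IsBitFlipSample.map_output {Ω : Type*} [MeasurableSpace Ω] {P : Measure Ω}
    [IsProbabilityMeasure P] {n d : ℕ} {ε : ℝ} {p : Fin d → ℝ}
    {X Z : Fin n → Ω → (Fin d → Bool)} (h : IsBitFlipSample ε p X Z P) (i : Fin n) :
    P.map (Z i) = ∑ j, ENNReal.ofReal (p j) • Measure.pi fun l => flipBit ε (oneHot j l) := by
  have hc := h.hasCondDistrib_output i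
  have h1 : (P.map (fun ω => (X i ω, Z i ω))).snd = P.map (Z i) :=
    Measure.snd_map_prodMk₀ hc.aemeasurable_fst
  rw [← h1, HasLaw.map_eq hc, Measure.snd_compProd, (h.hasLaw_data i).map_eq, multinomialOne]
  ext s hs
  rw [Measure.bind_apply hs (by fun_prop)]
  simp [bitFlip, Kernel.ofFunOfCountable]

lemma IsBitFlipSample.charFun_map_comp {Ω : Type*} [MeasurableSpace Ω] {P : Measure Ω}
    [IsProbabilityMeasure P] {n d : ℕ} {ε : ℝ} {p : Fin d → ℝ} (hp : ∀ j, 0 ≤ p j)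
    {X Z : Fin n → Ω → (Fin d → Bool)} (h : IsBitFlipSample ε p X Z P) (f : (Fin d → Bool) → ℝ)
    (i : Fin n) (t : ℝ) :
    charFun (P.map fun ω => f (Z i ω)) t = ∑ j, (p j : ℂ) *
      charFun ((Measure.pi fun l => flipBit ε (oneHot j l)).map f) t := by
  have hf : Measurable f := .of_discrete
  have hZ : AEMeasurable (Z i) P := (h.hasCondDistrib_output i).aemeasurable_snd
  have e : P.map (fun ω => f (Z i ω)) = (P.map (Z i)).map f :=
    (AEMeasurable.map_map_of_aemeasurable hf.aemeasurable hZ).symm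
  rw [e]
  simp only [charFun_apply]
  have hg : ∀ μ : Measure (Fin d → Bool), ∫ x, Complex.exp ((inner ℝ x t : ℝ) * Complex.I) ∂(μ.map f)
      = ∫ z, Complex.exp ((inner ℝ (f z) t : ℝ) * Complex.I) ∂μ := fun μ =>
    integral_map hf.aemeasurable (Continuous.aestronglyMeasurable (by fun_prop))
  simp only [hg, h.map_output]
  rw [integral_finsetSum_measure fun j _ =>
    (Integrable.of_finite (μ := Measure.pi fun l => flipBit ε (oneHot j l))).smul_measure
      ENNReal.ofReal_ne_top]
  refine Finset.sum_congr rfl fun j _ => ?_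
  rw [integral_smul_measure, ENNReal.toReal_ofReal (hp j), Complex.real_smul]

lemma IsBitFlipSample.charFun_map_sum {Ω : Type*} [MeasurableSpace Ω] {P : Measure Ω}
    [IsProbabilityMeasure P] {n d : ℕ} {ε : ℝ} {p : Fin d → ℝ} (hp : ∀ j, 0 ≤ p j)
    {X Z : Fin n → Ω → (Fin d → Bool)} (h : IsBitFlipSample ε p X Z P) (f : (Fin d → Bool) → ℝ)
    (t : ℝ) :
    charFun (P.map fun ω => ∑ i, f (Z i ω)) t = (∑ j, (p j : ℂ) *
      charFun ((Measure.pi fun l => flipBit ε (oneHot j l)).map f) t) ^ n := by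
  have hf : Measurable f := .of_discrete
  have hZ : ∀ i, AEMeasurable (Z i) P := fun i => (h.hasCondDistrib_output i).aemeasurable_snd
  have hind : iIndepFun (fun i ω => f (Z i ω)) P :=
    h.indep.comp (fun _ x => f x.2) fun _ => hf.comp measurable_snd
  rw [iIndepFun.charFun_map_fun_sum_eq_prod (X := fun i ω => f (Z i ω))
    (fun i => hf.comp_aemeasurable (hZ i)) hind]
  simp [h.charFun_map_comp hp]

/-! ### Moments of linear statistics and the covariance matrix -/

/-- The centered linear statistic of one report. -/
noncomputable def linearStat {d : ℕ} (τ c : Fin d → ℝ) (z : Fin d → Bool) : ℝ :=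
  ∑ j, τ j * ((if z j then 1 else 0) - c j)

lemma integral_flipBit (ε : ℝ) (b : Bool) (g : Bool → ℝ) :
    ∫ x, g x ∂(flipBit ε b) = Real.exp (ε / 2) / (Real.exp (ε / 2) + 1) * g b +
      1 / (Real.exp (ε / 2) + 1) * g (!b) := by
  have h : 0 < Real.exp (ε / 2) := Real.exp_pos _
  rw [flipBit, integral_add_measure (Integrable.of_finite.smul_measure ENNReal.ofReal_ne_top)
    (Integrable.of_finite.smul_measure ENNReal.ofReal_ne_top), integral_smul_measure,
    integral_smul_measure, integral_dirac, integral_dirac, ENNReal.toReal_ofReal (by positivity),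
    ENNReal.toReal_ofReal (by positivity), smul_eq_mul, smul_eq_mul]

lemma integral_linearStat {d : ℕ} (ε : ℝ) (τ p : Fin d → ℝ) (k : Fin d) :
    ∫ z, linearStat τ (flippedMean ε p) z ∂(Measure.pi fun l => flipBit ε (oneHot k l)) =
      alphaCoeff ε * (τ k - p ⬝ᵥ τ) := by
  have h : 0 < Real.exp (ε / 2) := Real.exp_pos _
  simp only [linearStat]
  rw [integral_finsetSum _ fun j _ => .of_finite]
  have e : ∀ j, ∫ z : Fin d → Bool, τ j * ((if z j then 1 else 0) - flippedMean ε p j)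
      ∂(Measure.pi fun l => flipBit ε (oneHot k l)) =
      alphaCoeff ε * ((if j = k then τ j else 0) - p j * τ j) := by
    intro j
    rw [integral_comp_eval (μ := fun l => flipBit ε (oneHot k l)) (i := j)
      (f := fun b : Bool => τ j * ((if b then 1 else 0) - flippedMean ε p j))
      (Measurable.of_discrete.aestronglyMeasurable), integral_flipBit]
    by_cases hj : j = k <;> simp [oneHot, hj, flippedMean, alphaCoeff] <;> field_simp <;> ring
  simp_rw [e, ← Finset.mul_sum, Finset.sum_sub_distrib, dotProduct]
  simp

/-- Variance plus squared mean. Keeping or flipping a bit gives the same variance whichever bit it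
is, so the variance term does not depend on `k`. -/
lemma integral_linearStat_sq {d : ℕ} (ε : ℝ) (τ p : Fin d → ℝ) (k : Fin d) :
    ∫ z, linearStat τ (flippedMean ε p) z ^ 2 ∂(Measure.pi fun l => flipBit ε (oneHot k l)) =
      (Real.exp (ε / 2) / (Real.exp (ε / 2) + 1) ^ 2) * (τ ⬝ᵥ τ) +
        (alphaCoeff ε * (τ k - p ⬝ᵥ τ)) ^ 2 := by
  have h : 0 < Real.exp (ε / 2) := Real.exp_pos _
  have hL : ∀ (μ : Measure Bool) [IsProbabilityMeasure μ] (g : Bool → ℝ), MemLp g 2 μ :=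
    fun μ _ g => .of_discrete
  have hv := variance_sum_pi (μ := fun l => flipBit ε (oneHot k l))
    (X := fun j (b : Bool) => τ j * ((if b then 1 else 0) - flippedMean ε p j)) fun j => hL _ _
  have hfun : (∑ j, fun z : Fin d → Bool => τ j * ((if z j then 1 else 0) - flippedMean ε p j)) =
      linearStat τ (flippedMean ε p) := by
    ext z; simp [linearStat]
  rw [hfun, variance_eq_sub .of_discrete, integral_linearStat] at hv
  simp only [Pi.pow_apply] at hv
  rw [sub_eq_iff_eq_add.1 hv, show τ ⬝ᵥ τ = ∑ j, τ j * τ j from rfl, Finset.mul_sum]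
  congr 1
  refine Finset.sum_congr rfl fun j _ => ?_
  rw [variance_eq_sub (hL _ _)]
  simp only [Pi.pow_apply]
  rw [integral_flipBit, integral_flipBit]
  by_cases hj : j = k <;> simp [oneHot, hj] <;> field_simp <;> ring

lemma flippedCov_mulVec {d : ℕ} (ε : ℝ) (p x : Fin d → ℝ) (j : Fin d) :
    (flippedCov ε p *ᵥ x) j = alphaCoeff ε ^ 2 * (p j * (x j - p ⬝ᵥ x)) +
      (Real.exp (ε / 2) / (Real.exp (ε / 2) + 1) ^ 2) * x j := by
  simp only [flippedCov, Matrix.add_mulVec, Matrix.sub_mulVec, Matrix.smul_mulVec,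
    Matrix.vecMulVec_mulVec, Matrix.mulVec_diagonal, Matrix.one_mulVec, Pi.add_apply,
    Pi.smul_apply, Pi.sub_apply, smul_eq_mul, MulOpposite.smul_eq_mul_unop, MulOpposite.unop_op]
  ring

/-- The right side is the `p`-average of the conditional second moments in `integral_linearStat_sq`,
which identifies `Σ(p)` as the covariance of a report. -/
lemma dotProduct_flippedCov_mulVec {d : ℕ} (ε : ℝ) (p x : Fin d → ℝ) (hp : ∑ j, p j = 1) :
    x ⬝ᵥ (flippedCov ε p *ᵥ x) = ∑ k, p k * ((Real.exp (ε / 2) / (Real.exp (ε / 2) + 1) ^ 2) *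
      (x ⬝ᵥ x) + (alphaCoeff ε * (x k - p ⬝ᵥ x)) ^ 2) := by
  have e1 : ∑ k, p k * x k = p ⬝ᵥ x := rfl
  have e2 : ∑ k, x k * x k = x ⬝ᵥ x := rfl
  set s := p ⬝ᵥ x
  set c := Real.exp (ε / 2) / (Real.exp (ε / 2) + 1) ^ 2
  have lhs : x ⬝ᵥ (flippedCov ε p *ᵥ x) =
      alphaCoeff ε ^ 2 * ∑ k, p k * x k ^ 2 - alphaCoeff ε ^ 2 * s * s + c * (x ⬝ᵥ x) := by
    rw [← e2]
    nth_rw 2 [← e1]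
    rw [Finset.mul_sum, Finset.mul_sum, Finset.mul_sum, dotProduct, ← Finset.sum_sub_distrib,
      ← Finset.sum_add_distrib]
    refine Finset.sum_congr rfl fun j _ => ?_
    rw [flippedCov_mulVec]
    ring
  have rhs : ∀ k, p k * (c * (x ⬝ᵥ x) + (alphaCoeff ε * (x k - s)) ^ 2) =
      c * (x ⬝ᵥ x) * p k + alphaCoeff ε ^ 2 * (p k * x k ^ 2) -
        2 * alphaCoeff ε ^ 2 * s * (p k * x k) + alphaCoeff ε ^ 2 * s ^ 2 * p k := fun k => by ring
  simp_rw [lhs, rhs, Finset.sum_add_distrib, Finset.sum_sub_distrib, Finset.sum_add_distrib,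
    ← Finset.mul_sum]
  rw [e1, hp]
  ring

lemma flippedCov_posDef {d : ℕ} (ε : ℝ) (p : Fin d → ℝ) (hp₀ : ∀ j, 0 ≤ p j)
    (hp : ∑ j, p j = 1) : (flippedCov ε p).PosDef := by
  have hc : 0 < Real.exp (ε / 2) / (Real.exp (ε / 2) + 1) ^ 2 := by positivity
  refine Matrix.PosDef.of_dotProduct_mulVec_pos ?_ fun x hx => ?_
  · ext i j
    simp only [flippedCov, Matrix.conjTranspose_apply, Matrix.add_apply, Matrix.smul_apply,
      Matrix.sub_apply, Matrix.vecMulVec_apply, Matrix.diagonal_apply, Matrix.one_apply, star_trivial,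
      smul_eq_mul]
    by_cases h : i = j
    · subst h; rfl
    · simp [h, Ne.symm h, mul_comm]
  · have hxx : 0 < x ⬝ᵥ x := by simpa using Matrix.dotProduct_star_self_pos_iff.2 hx
    rw [star_trivial, dotProduct_flippedCov_mulVec ε p x hp]
    calc 0 < ∑ k, p k * (Real.exp (ε / 2) / (Real.exp (ε / 2) + 1) ^ 2 * (x ⬝ᵥ x)) := by
          rw [← Finset.sum_mul, hp]; positivity
      _ ≤ _ := Finset.sum_le_sum fun k _ =>
          mul_le_mul_of_nonneg_left (le_add_of_nonneg_right (sq_nonneg _)) (hp₀ k)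

/-! ### Whitening the projected quadratic form -/

lemma centering_mulVec {d : ℕ} (v : Fin d → ℝ) :
    centering d *ᵥ v = v - ((∑ j, v j) / d) • (fun _ => (1 : ℝ)) := by
  ext j
  simp [centering, Matrix.sub_mulVec, Matrix.smul_mulVec, Matrix.vecMulVec_mulVec, dotProduct,
    div_eq_inv_mul]

lemma centering_transpose (d : ℕ) : (centering d)ᵀ = centering d := by
  simp [centering, Matrix.transpose_sub, Matrix.transpose_smul, Matrix.transpose_vecMulVec]

open scoped RealInnerProductSpace in
/-- An orthonormal basis whose last vector is along `a` and whose first vector is along `b ⊥ a`. -/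
lemma exists_orthonormalBasis_adapted {m : ℕ} {E : Type*} [NormedAddCommGroup E]
    [InnerProductSpace ℝ E] [FiniteDimensional ℝ E] (hE : Module.finrank ℝ E = m + 1)
    (a b : E) (ha : a ≠ 0) (hab : ⟪a, b⟫ = 0) (hb : m = 0 → b = 0) :
    ∃ u : OrthonormalBasis (Fin (m + 1)) ℝ E, a = ‖a‖ • u (Fin.last m) ∧ b = ‖b‖ • u 0 := by
  classical
  let v : Fin (m + 1) → E := fun i => if i = Fin.last m then ‖a‖⁻¹ • a else ‖b‖⁻¹ • b
  -- Index `0` is prescribed only when `b ≠ 0`, since otherwise `‖b‖⁻¹ • b` is not a unit vector;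
  -- for `b = 0` any `u 0` will do.
  let s : Set (Fin (m + 1)) := {i | i = Fin.last m ∨ (i = 0 ∧ b ≠ 0)}
  have hs : Orthonormal ℝ (s.domRestrict v) := by
    constructor
    · rintro ⟨i, hi⟩
      by_cases h : i = Fin.last m
      · simp [v, Set.domRestrict_apply, h, norm_smul, ha]
      · have hb' : b ≠ 0 := (hi.resolve_left h).2
        simp [v, Set.domRestrict_apply, h, norm_smul, hb']
    · rintro ⟨i, hi⟩ ⟨j, hj⟩ hij
      have hij' : i ≠ j := fun h => hij (Subtype.ext h)
      by_cases h : i = Fin.last m <;> by_cases h' : j = Fin.last m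
      · exact absurd (h.trans h'.symm) hij'
      · simp [v, Set.domRestrict_apply, h, h', inner_smul_left, inner_smul_right, hab]
      · simp [v, Set.domRestrict_apply, h, h', inner_smul_left, inner_smul_right,
          real_inner_comm a b, hab]
      · exact absurd ((hi.resolve_left h).1.trans (hj.resolve_left h').1.symm) hij'
  obtain ⟨u, hu⟩ := hs.exists_orthonormalBasis_extension_of_card_eq (by simp [hE])
  refine ⟨u, ?_, ?_⟩
  · rw [hu _ (Or.inl rfl)]
    simp [v, smul_smul, ha]
  · by_cases h : b = 0
    · simp [h]
    · rw [hu 0 (Or.inr ⟨rfl, h⟩)]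
      have h0 : (0 : Fin (m + 1)) ≠ Fin.last m := fun h' =>
        h (hb (by simpa using congrArg Fin.val h'.symm))
      simp [v, h0, smul_smul, h]

/-- Vectors that whiten the projected report: the statistic is the sum of the squares of the
coordinates along them. -/
lemma exists_whitening {m : ℕ} (ε : ℝ) (p : Fin (m + 1) → ℝ) (hp₀ : ∀ j, 0 ≤ p j)
    (hp : ∑ j, p j = 1) (Δ : Fin (m + 1) → ℝ) (hΔ : ∑ j, Δ j = 0) :
    ∃ b : Fin m → Fin (m + 1) → ℝ,
      (∀ v, v ⬝ᵥ ((centering (m + 1) * (flippedCov ε p)⁻¹ * centering (m + 1)) *ᵥ v) =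
        ∑ i, (b i ⬝ᵥ v) ^ 2) ∧
      (∀ i j, b i ⬝ᵥ (flippedCov ε p *ᵥ b j) = if i = j then 1 else 0) ∧
      (∀ i, b i ⬝ᵥ Δ = if (i : ℕ) = 0 then √(Δ ⬝ᵥ ((flippedCov ε p)⁻¹ *ᵥ Δ)) else 0) := by
  have hS := flippedCov_posDef ε p hp₀ hp
  have hdet : IsUnit (flippedCov ε p).det := (Matrix.isUnit_iff_isUnit_det _).1 hS.isUnit
  set S := flippedCov ε p with hSdef
  obtain ⟨C, hC⟩ : ∃ C : Matrix (Fin (m + 1)) (Fin (m + 1)) ℝ, S⁻¹ = Cᵀ * C := by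
    open scoped MatrixOrder in
    obtain ⟨C, hC⟩ := CStarAlgebra.nonneg_iff_eq_star_mul_self.1 hS.inv.posSemidef.nonneg
    exact ⟨C, by simpa [Matrix.star_eq_conjTranspose] using hC⟩
  have hCSC : C * S * Cᵀ = 1 := by
    rw [mul_eq_one_comm, ← mul_assoc, ← hC, Matrix.nonsing_inv_mul _ hdet]
  let L : (Fin (m + 1) → ℝ) → EuclideanSpace ℝ (Fin (m + 1)) := fun v => WithLp.toLp 2 (C *ᵥ v)
  have hinner : ∀ (u : EuclideanSpace ℝ (Fin (m + 1))) (v : Fin (m + 1) → ℝ),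
      inner ℝ u (L v) = (Cᵀ *ᵥ u.ofLp) ⬝ᵥ v := by
    intro u v
    rw [Matrix.mulVec_transpose, ← Matrix.dotProduct_mulVec, EuclideanSpace.inner_eq_star_dotProduct]
    simp [L, dotProduct_comm]
  have hLL : ∀ v w, inner ℝ (L v) (L w) = v ⬝ᵥ (S⁻¹ *ᵥ w) := by
    intro v w
    rw [real_inner_comm, hinner, hC, dotProduct_comm]
    simp only [L, Matrix.mulVec_mulVec]
  have hLsub : ∀ (v w : Fin (m + 1) → ℝ) (r : ℝ), L (v - r • w) = L v - r • L w := by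
    intro v w r
    simp [L, Matrix.mulVec_sub, Matrix.mulVec_smul]
  set c := Real.exp (ε / 2) / (Real.exp (ε / 2) + 1) ^ 2 with hc
  have hcpos : 0 < c := by positivity
  let one : Fin (m + 1) → ℝ := fun _ => 1
  -- The multinomial part of `S` kills `one` because `p` sums to one; only the flipping noise `c`
  -- remains.
  have hS1 : S *ᵥ one = c • one := by
    ext j
    rw [hSdef, flippedCov_mulVec]
    simp [one, dotProduct, hp, c]
  have hSinv1 : S⁻¹ *ᵥ one = c⁻¹ • one := by
    have := congrArg (fun v => c⁻¹ • (S⁻¹ *ᵥ v)) hS1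
    simp only [Matrix.mulVec_mulVec, Matrix.nonsing_inv_mul _ hdet, Matrix.one_mulVec,
      Matrix.mulVec_smul, smul_smul, inv_mul_cancel₀ hcpos.ne', one_smul] at this
    exact this.symm
  have hL1 : ∀ v, inner ℝ (L one) (L v) = c⁻¹ * ∑ j, v j := by
    intro v
    rw [real_inner_comm, hLL, hSinv1]
    simp [one, dotProduct, ← Finset.sum_mul, mul_comm]
  have hL1ne : L one ≠ 0 := by
    intro h
    have := hL1 one
    rw [h, inner_zero_left] at this
    have h2 : 0 < c⁻¹ * ∑ j, one j := mul_pos (inv_pos.2 hcpos) (by simp [one]; positivity)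
    exact h2.ne this
  -- For `m = 0` the first and last axes coincide, but then the zero sum forces `Δ = 0`.
  obtain ⟨u, hu1, hu0⟩ := exists_orthonormalBasis_adapted (m := m) (by simp) (L one) (L Δ) hL1ne
    (by rw [hL1, hΔ, mul_zero]) (by
      rintro rfl
      have : Δ = 0 := by ext j; fin_cases j; simpa using hΔ
      simp [this, L])
  have hu1' : ∀ i : Fin m, inner ℝ (u i.castSucc) (L one) = 0 := by
    intro i
    rw [hu1, inner_smul_right, u.inner_eq_ite, if_neg (Fin.castSucc_lt_last i).ne, mul_zero]
  refine ⟨fun i => Cᵀ *ᵥ (u i.castSucc).ofLp, fun v => ?_, fun i j => ?_, fun i => ?_⟩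
  · set w := centering (m + 1) *ᵥ v with hw
    have hwv : w = v - ((∑ j, v j) / (m + 1 : ℕ)) • one := centering_mulVec v
    have hwsum : ∑ j, w j = 0 := by
      rw [hwv]
      simp [one, Finset.sum_sub_distrib]
      field_simp
      ring
    have h1 : v ⬝ᵥ ((centering (m + 1) * S⁻¹ * centering (m + 1)) *ᵥ v) = ‖L w‖ ^ 2 := by
      rw [← real_inner_self_eq_norm_sq, hLL, ← Matrix.mulVec_mulVec, ← Matrix.mulVec_mulVec,
        Matrix.dotProduct_mulVec, ← Matrix.mulVec_transpose, centering_transpose]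
    rw [h1, ← u.sum_sq_inner_right, Fin.sum_univ_castSucc]
    have h2 : inner ℝ (u (Fin.last m)) (L w) = 0 := by
      have h3 : inner ℝ (L one) (L w) = 0 := by rw [hL1, hwsum, mul_zero]
      rw [hu1, inner_smul_left] at h3
      exact (mul_eq_zero.1 h3).resolve_left (by simpa using hL1ne)
    rw [h2, zero_pow two_ne_zero, add_zero]
    refine Finset.sum_congr rfl fun i _ => ?_
    -- Centering changes `v` by a multiple of `one`, invisible along the axes orthogonal to `L one`.
    rw [hwv, hLsub, inner_sub_right, inner_smul_right, hu1', mul_zero, sub_zero, hinner]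
  · rw [← hinner]
    have h4 : L (S *ᵥ (Cᵀ *ᵥ (u j.castSucc).ofLp)) = u j.castSucc := by
      simp only [L, Matrix.mulVec_mulVec, ← mul_assoc, hCSC, Matrix.one_mulVec]
    rw [h4, u.inner_eq_ite]
    simp
  · rw [← hinner, hu0, inner_smul_right, u.inner_eq_ite, ← hLL, real_inner_self_eq_norm_sq,
      Real.sqrt_sq (norm_nonneg _)]
    have h5 : (i.castSucc = 0) ↔ (i : ℕ) = 0 := by simp [Fin.ext_iff]
    simp only [h5]
    split_ifs <;> simp

/-! ### Convergence of the statistic -/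

/-- `ENNReal.ofReal` truncates negative weights, so the mixture formula for characteristic functions
needs nonnegative ones. -/
lemma eventually_localAlternative_nonneg {d : ℕ} (p₀ Δ : Fin d → ℝ) (hp₀ : ∀ j, 0 < p₀ j) :
    ∀ᶠ n : ℕ in atTop, ∀ j, 0 ≤ localAlternative p₀ Δ n j := by
  refine eventually_all.2 fun j => ?_
  have h : Tendsto (fun n : ℕ => p₀ j + Δ j / √(n : ℝ)) atTop (𝓝 (p₀ j + 0)) :=
    tendsto_const_nhds.add (Tendsto.div_atTop tendsto_const_nhds
      (Real.tendsto_sqrt_atTop.comp tendsto_natCast_atTop_atTop))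
  rw [add_zero] at h
  exact (h.eventually (lt_mem_nhds (hp₀ j))).mono fun n hn => le_of_lt hn

/-- The rescaled and centered private histogram tested against `τ`. -/
noncomputable def scaledStat {Ω : Type*} {n d : ℕ} (c τ : Fin d → ℝ)
    (Z : Fin n → Ω → (Fin d → Bool)) (ω : Ω) : ℝ :=
  √(n : ℝ) * (τ ⬝ᵥ fun j => privateHistogram Z ω j / n - c j)

lemma scaledStat_eq_sum {Ω : Type*} {n d : ℕ} (hn : 0 < n) (c τ : Fin d → ℝ)
    (Z : Fin n → Ω → (Fin d → Bool)) (ω : Ω) :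
    scaledStat c τ Z ω = (√(n : ℝ))⁻¹ * ∑ i, linearStat τ c (Z i ω) := by
  have hn' : (0 : ℝ) < n := by exact_mod_cast hn
  have hs : √(n : ℝ) = (√(n : ℝ))⁻¹ * n := by
    rw [eq_inv_mul_iff_mul_eq₀ (Real.sqrt_pos.2 hn').ne', Real.mul_self_sqrt hn'.le]
  rw [scaledStat, hs, mul_assoc]
  simp only [linearStat]
  rw [← hs, Finset.sum_comm, dotProduct, Finset.mul_sum]
  congr 1
  refine Finset.sum_congr rfl fun j _ => ?_
  rw [← Finset.mul_sum, Finset.sum_sub_distrib, privateHistogram]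
  simp
  field_simp

lemma aemeasurable_scaledStat {Ω : Type*} [MeasurableSpace Ω] {P : Measure Ω} {n d : ℕ}
    (c τ : Fin d → ℝ) {Z : Fin n → Ω → (Fin d → Bool)} (hZ : ∀ i, AEMeasurable (Z i) P) :
    AEMeasurable (scaledStat c τ Z) P := by
  have h : ∀ (j : Fin d) (i : Fin n), AEMeasurable (fun ω => if Z i ω j then (1 : ℝ) else 0) P :=
    fun j i => (Measurable.of_discrete (f := fun z : Fin d → Bool =>
      if z j then (1 : ℝ) else 0)).comp_aemeasurable (hZ i)
  unfold scaledStat privateHistogram dotProduct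
  fun_prop

/-- The limit of the characteristic functions of the linear statistics. -/
lemma tendsto_charFun_scaledStat {d : ℕ} (ε : ℝ) (p₀ Δ τ : Fin d → ℝ) (hp₀ : ∀ j, 0 < p₀ j)
    (hsum : ∑ j, p₀ j = 1) (hΔ : ∑ j, Δ j = 0) {Ω : ℕ → Type*} [∀ n, MeasurableSpace (Ω n)]
    (P : ∀ n, Measure (Ω n)) [∀ n, IsProbabilityMeasure (P n)]
    (X Z : ∀ n, Fin n → Ω n → (Fin d → Bool))
    (h : ∀ᶠ n in atTop, IsBitFlipSample ε (localAlternative p₀ Δ n) (X n) (Z n) (P n)) :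
    Tendsto (fun n => charFun ((P n).map (scaledStat (flippedMean ε p₀) τ (Z n))) 1) atTop
      (𝓝 (Complex.exp (((alphaCoeff ε * (τ ⬝ᵥ Δ) : ℝ) : ℂ) * Complex.I -
        ((τ ⬝ᵥ (flippedCov ε p₀ *ᵥ τ) : ℝ) : ℂ) / 2))) := by
  set f := linearStat τ (flippedMean ε p₀)
  have hf : Measurable f := .of_discrete
  let ν : Fin d → Measure ℝ := fun k => (Measure.pi fun l => flipBit ε (oneHot k l)).map f
  have : ∀ k, IsProbabilityMeasure (ν k) := fun k =>
    Measure.isProbabilityMeasure_map hf.aemeasurable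
  have hL : ∀ k, MemLp id 2 (ν k) := fun k =>
    (memLp_map_measure_iff aestronglyMeasurable_id hf.aemeasurable).2 .of_discrete
  have hm : ∀ k, ∫ x, x ∂(ν k) = alphaCoeff ε * (τ k - p₀ ⬝ᵥ τ) := fun k => by
    rw [integral_map hf.aemeasurable (Continuous.aestronglyMeasurable (by fun_prop)),
      integral_linearStat]
  have hq : ∀ k, ∫ x, x ^ 2 ∂(ν k) = (Real.exp (ε / 2) / (Real.exp (ε / 2) + 1) ^ 2) * (τ ⬝ᵥ τ) +
        (alphaCoeff ε * (τ k - p₀ ⬝ᵥ τ)) ^ 2 := fun k => by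
    rw [integral_map hf.aemeasurable (Continuous.aestronglyMeasurable (by fun_prop)),
      integral_linearStat_sq]
  have e : ∀ q : Fin d → ℝ, ∑ k, q k * (alphaCoeff ε * (τ k - p₀ ⬝ᵥ τ)) =
      alphaCoeff ε * (τ ⬝ᵥ q) - alphaCoeff ε * (p₀ ⬝ᵥ τ) * ∑ k, q k := by
    intro q
    rw [dotProduct_comm τ q]
    nth_rw 2 [dotProduct]
    rw [Finset.mul_sum, Finset.mul_sum, ← Finset.sum_sub_distrib]
    exact Finset.sum_congr rfl fun k _ => by ring
  have key := tendsto_mixture_charFun_pow ν hL p₀ Δ hsum hΔ (by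
    simp_rw [hm, e, hsum, dotProduct_comm τ p₀]; ring)
  simp_rw [hm, hq, e, hΔ, ← dotProduct_flippedCov_mulVec ε p₀ τ hsum, mul_zero, sub_zero] at key
  refine key.congr' ?_
  filter_upwards [h, eventually_localAlternative_nonneg p₀ Δ hp₀, eventually_gt_atTop 0]
    with n hn hpos hn0
  have e2 : scaledStat (flippedMean ε p₀) τ (Z n) =
      fun ω => (√(n : ℝ))⁻¹ * ∑ i, f (Z n i ω) := funext (scaledStat_eq_sum hn0 _ _ _)
  have hZ : ∀ i, AEMeasurable (Z n i) (P n) := fun i =>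
    (hn.hasCondDistrib_output i).aemeasurable_snd
  have hfZ : AEMeasurable (fun ω => ∑ i, f (Z n i ω)) (P n) :=
    Finset.aemeasurable_fun_sum _ fun i _ => hf.comp_aemeasurable (hZ i)
  rw [e2, charFun_map_mul_comp hfZ, hn.charFun_map_sum hpos, mul_one]
  rfl

/-- The statistic converges in law to a noncentral chi-square under local alternatives. -/
lemma tendstoInDistribution_bitFlipStatistic {m : ℕ} {ε : ℝ} (hε : 0 < ε)
    (p₀ Δ : Fin (m + 1) → ℝ) (hp₀ : ∀ j, 0 < p₀ j)
    (hsum : ∑ j, p₀ j = 1) (hΔ : ∑ j, Δ j = 0) {Ω : ℕ → Type*} [∀ n, MeasurableSpace (Ω n)]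
    (P : ∀ n, Measure (Ω n)) [∀ n, IsProbabilityMeasure (P n)]
    (X Z : ∀ n, Fin n → Ω n → (Fin (m + 1) → Bool)) (hZ : ∀ n i, AEMeasurable (Z n i) (P n))
    (h : ∀ᶠ n in atTop, IsBitFlipSample ε (localAlternative p₀ Δ n) (X n) (Z n) (P n)) :
    TendstoInDistribution (fun n => bitFlipStatistic ε p₀ (Z n)) atTop (id : ℝ → ℝ) P
      (noncentralChiSquare m (alphaCoeff ε ^ 2 * (Δ ⬝ᵥ ((flippedCov ε p₀)⁻¹ *ᵥ Δ)))) := by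
  obtain ⟨b, hb, hbS, hbΔ⟩ := exists_whitening ε p₀ (fun j => (hp₀ j).le) hsum Δ hΔ
  set lam := alphaCoeff ε ^ 2 * (Δ ⬝ᵥ ((flippedCov ε p₀)⁻¹ *ᵥ Δ)) with hlam
  -- The sign matters: the first limiting mean is `α` times a square root, and it has to equal
  -- `√lam`, not `-√lam`.
  have hα : 0 ≤ alphaCoeff ε := by
    have : 1 ≤ Real.exp (ε / 2) := Real.one_le_exp (by positivity)
    exact div_nonneg (by linarith) (by positivity)
  have hsqrt : √lam = alphaCoeff ε * √(Δ ⬝ᵥ ((flippedCov ε p₀)⁻¹ *ᵥ Δ)) := by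
    rw [hlam, Real.sqrt_mul (sq_nonneg _), Real.sqrt_sq hα]
  let mean : Fin m → ℝ := fun i => if (i : ℕ) = 0 then √lam else 0
  let W : ∀ n, Ω n → EuclideanSpace ℝ (Fin m) := fun n ω =>
    WithLp.toLp 2 fun i => scaledStat (flippedMean ε p₀) (b i) (Z n) ω
  have hWm : ∀ n, AEMeasurable (W n) (P n) := fun n =>
    (WithLp.measurable_toLp 2 _).comp_aemeasurable
      (aemeasurable_pi_lambda _ fun i => aemeasurable_scaledStat _ _ (hZ n))
  have hW : TendstoInDistribution W atTop (WithLp.toLp 2 : (Fin m → ℝ) → EuclideanSpace ℝ (Fin m))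
      P (Measure.pi fun i => gaussianReal (mean i) 1) := by
    refine ⟨hWm, (WithLp.measurable_toLp 2 _).aemeasurable, ?_⟩
    refine ProbabilityMeasure.tendsto_iff_tendsto_charFun.2 fun t => ?_
    -- Cramér–Wold: the characteristic function of `W n` at `t` is that of the scalar statistic
    -- tested against `τ`, at `1`.
    let τ : Fin (m + 1) → ℝ := ∑ i, t i • b i
    have hWτ : ∀ n ω, inner ℝ (W n ω) t = scaledStat (flippedMean ε p₀) τ (Z n) ω := by
      intro n ω
      simp only [W, PiLp.inner_apply, scaledStat, τ, sum_dotProduct, smul_dotProduct,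
        Finset.mul_sum]
      refine Finset.sum_congr rfl fun i _ => ?_
      simp
      ring
    have hτΔ : alphaCoeff ε * (τ ⬝ᵥ Δ) = ∑ i, t i * mean i := by
      simp only [τ, sum_dotProduct, smul_dotProduct, hbΔ, Finset.mul_sum, mean, hsqrt, smul_eq_mul]
      exact Finset.sum_congr rfl fun i _ => by split_ifs <;> ring
    have hττ : τ ⬝ᵥ (flippedCov ε p₀ *ᵥ τ) = ∑ i, t i ^ 2 := by
      simp only [τ, Matrix.mulVec_sum, Matrix.mulVec_smul, sum_dotProduct, dotProduct_sum,
        smul_dotProduct, dotProduct_smul, hbS, smul_eq_mul]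
      simp [pow_two]
    have key := tendsto_charFun_scaledStat ε p₀ Δ τ hp₀ hsum hΔ P X Z h
    rw [hτΔ, hττ] at key
    have hlim : charFun ((Measure.pi fun i => gaussianReal (mean i) 1).map (WithLp.toLp 2)) t =
        Complex.exp (((∑ i, t i * mean i : ℝ) : ℂ) * Complex.I - ((∑ i, t i ^ 2 : ℝ) : ℂ) / 2) := by
      rw [charFun_pi]
      simp_rw [charFun_gaussianReal]
      rw [← Complex.exp_sum, Finset.sum_sub_distrib, ← Finset.sum_mul, ← Finset.sum_div]
      simp
    have hfin : ∀ n, charFun ((P n).map (W n)) t =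
        charFun ((P n).map (scaledStat (flippedMean ε p₀) τ (Z n))) 1 := by
      intro n
      rw [charFun_apply, charFun_apply, integral_map (hWm n)
        (Continuous.aestronglyMeasurable (by fun_prop)),
        integral_map (aemeasurable_scaledStat _ _ (hZ n))
        (Continuous.aestronglyMeasurable (by fun_prop))]
      simp [hWτ]
    simp only [ProbabilityMeasure.coe_mk, hfin, hlim]
    exact key
  have hT := hW.continuous_comp (g := fun x : EuclideanSpace ℝ (Fin m) => ∑ i, x i ^ 2)
    (by fun_prop)
  have hTW : (fun n => (fun x : EuclideanSpace ℝ (Fin m) => ∑ i, x i ^ 2) ∘ W n) =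
      fun n => bitFlipStatistic ε p₀ (Z n) := by
    ext n ω
    simp only [Function.comp_apply, W, bitFlipStatistic, hb, scaledStat, mul_pow,
      Real.sq_sqrt (Nat.cast_nonneg n), Finset.mul_sum]
  rw [hTW] at hT
  refine ⟨hT.forall_aemeasurable, aemeasurable_id, ?_⟩
  convert! hT.tendsto using 2
  refine congrArg _ (Subtype.ext ?_)
  simp only [Measure.map_id, noncentralChiSquare]
  rfl

lemma localAlternative_zero {d : ℕ} (p₀ : Fin d → ℝ) (n : ℕ) : localAlternative p₀ 0 n = p₀ := by
  ext j; simp [localAlternative]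

lemma noncentralChiSquare_zero (k : ℕ) : noncentralChiSquare k 0 = chiSquare k := by
  simp [noncentralChiSquare, chiSquare]

end BitFlipGOF

theorem mainTheorem2 {d : ℕ} {ε : ℝ} (hε : 0 < ε) (p₀ : Fin d → ℝ) (hp₀ : ∀ j, 0 < p₀ j)
    (hsum : ∑ j, p₀ j = 1)
    {Ω : ℕ → Type*} [∀ n, MeasurableSpace (Ω n)] (P : ∀ n, Measure (Ω n))
    [∀ n, IsProbabilityMeasure (P n)]
    (X Z : ∀ n, Fin n → Ω n → (Fin d → Bool)) (hZ : ∀ n i, AEMeasurable (Z n i) (P n)) :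
    IsUnit (BitFlipGOF.flippedCov ε p₀).det ∧
    ((∀ᶠ n in atTop, BitFlipGOF.IsBitFlipSample ε p₀ (X n) (Z n) (P n)) →
      TendstoInDistribution (fun n => BitFlipGOF.bitFlipStatistic ε p₀ (Z n)) atTop
        (id : ℝ → ℝ) P (BitFlipGOF.chiSquare (d - 1))) ∧
    (∀ Δ : Fin d → ℝ, ∑ j, Δ j = 0 →
      (∀ᶠ n in atTop, BitFlipGOF.IsBitFlipSample ε (BitFlipGOF.localAlternative p₀ Δ n)
        (X n) (Z n) (P n)) →
      TendstoInDistribution (fun n => BitFlipGOF.bitFlipStatistic ε p₀ (Z n)) atTop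
        (id : ℝ → ℝ) P
        (BitFlipGOF.noncentralChiSquare (d - 1)
          (BitFlipGOF.alphaCoeff ε ^ 2 * (Δ ⬝ᵥ ((BitFlipGOF.flippedCov ε p₀)⁻¹ *ᵥ Δ))))) := by
  obtain _ | m := d
  · simp at hsum
  refine ⟨(Matrix.isUnit_iff_isUnit_det _).1
    (BitFlipGOF.flippedCov_posDef ε p₀ (fun j => (hp₀ j).le) hsum).isUnit, fun h => ?_,
    fun Δ hΔ h => BitFlipGOF.tendstoInDistribution_bitFlipStatistic hε p₀ Δ hp₀ hsum hΔ P X Z hZ h⟩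
  have key := BitFlipGOF.tendstoInDistribution_bitFlipStatistic hε p₀ 0 hp₀ hsum (by simp) P X Z hZ
    (by simpa only [BitFlipGOF.localAlternative_zero] using h)
  simp only [zero_dotProduct, mul_zero, BitFlipGOF.noncentralChiSquare_zero] at key
  exact key
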